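/- A sequence $C(n)$ of integers ($n\ge 0$) is said to satisfy the Lucas congruences if for every prime $p$ and every base-$p$ expansion $n=n_0+n_1p+\cdots+n_rp^r$ with $0\le n_i<p$, one has $C(n)\equiv C(n_0)C(n_1)\cdots C(n_r)\pmod p$. Theorem. Each of the following fifteen (sporadic Apéry-like) sequences satisfies the Lucas congruences; $k$ and $l$ run over $0,1,\ldots,n$ unless other limits are given, and $\binom{m}{j}=0$ for $j>m\ge 0$, terms with such a vanishing factor being $0$. Zagier's six sequences: - (a) $\sum_k\binom nk^3$; - (b) $\sum_k\binom nk^2\binom{n+k}{n}$; - (c) $\sum_k\binom nk^2\binom{2k}{k}$; - (d) $\sum_k\binom nk\binom{2k}{k}\binom{2(n-k)}{n-k}$; - (f) $\sum_k(-1)^k3^{n-3k}\binom{n}{3k}\frac{(3k)!}{k!^3}$; - (g) $\sum_{k,l}(-1)^k8^{n-k}\binom nk\binom kl^3$. The Almkvist–Zudilin sequences ($\delta$)–($\gamma$) and Cooper's sequences $s_7$, $s_{10}$, $s_{18}$: - ($\delta$) $\sum_k(-1)^k3^{n-3k}\binom{n}{3k}\binom{n+k}{n}\frac{(3k)!}{k!^3}$;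 - ($\eta$) $\sum_{k=0}^{\lfloor n/5\rfloor}(-1)^k\binom nk^3\left(\binom{4n-5k-1}{3n}+\binom{4n-5k}{3n}\right)$ for $n\ge1$, with value $1$ at $n=0$; - ($\alpha$) $\sum_k\binom nk^2\binom{2k}{k}\binom{2(n-k)}{n-k}$; - ($\epsilon$) $\sum_k\binom nk^2\binom{2k}{n}^2$; - ($\zeta$) $\sum_{k,l}\binom nk^2\binom nl\binom kl\binom{k+l}{n}$; - ($\gamma$) $\sum_k\binom nk^2\binom{n+k}{n}^2$; - $s_7(n)=\sum_k\binom nk^2\binom{n+k}{k}\binom{2k}{n}$; - $s_{10}(n)=\sum_k\binom nk^4$; - $s_{18}(n)=\sum_{k=0}^{\lfloor n/3\rfloor}(-1)^k\binom nk\binom{2k}{k}\binom{2(n-k)}{n-k}\left[\binom{2n-3k-1}{n}+\binom{2n-3k}{n}\right]$ for $n\ge1$, with $s_{18}(0)=1$. -/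

import Mathlib

open scoped Nat

/-- A sequence `a` of integers satisfies the Lucas congruences if, for every prime `p` and every
base-`p` expansion `n = n₀ + n₁ p + ⋯ + n_r p ^ r` with digits `0 ≤ nᵢ < p`, one has
`a n ≡ a n₀ * a n₁ * ⋯ * a n_r` modulo `p`. -/
def SatisfiesLucasCongruences (a : ℕ → ℤ) : Prop :=
  ∀ p : ℕ, p.Prime → ∀ (r n : ℕ) (d : ℕ → ℕ), (∀ i ≤ r, d i < p) →
    n = ∑ i ∈ Finset.range (r + 1), d i * p ^ i →
      a n ≡ ∏ i ∈ Finset.range (r + 1), a (d i) [ZMOD (p : ℤ)]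

namespace AperyLike

/-- `k!³` divides `(3k)!`, so the natural-number quotients `(3k)! / k!³` below are exact. -/
theorem factorial_pow_three_dvd (k : ℕ) : k ! ^ 3 ∣ (3 * k)! := by
  have h1 : k ! * k ! ∣ (k + k)! := Nat.factorial_mul_factorial_dvd_factorial_add k k
  have h2 : (k + k)! * k ! ∣ (k + k + k)! :=
    Nat.factorial_mul_factorial_dvd_factorial_add (k + k) k
  have h3 : 3 * k = k + k + k := by ring
  have h4 : k ! ^ 3 = k ! * k ! * k ! := by ring
  rw [h3, h4]
  exact (Nat.mul_dvd_mul_right h1 _).trans h2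

/-! Solutions of
`(n + 1)² u (n + 1) = (a n² + a n + b) u n - c n² u (n - 1)`, `u 0 = 1`. -/

/-- Sequence (a), with `(a, b, c) = (7, 2, -8)`. -/
def seqA (n : ℕ) : ℤ := ∑ k ∈ Finset.range (n + 1), (n.choose k : ℤ) ^ 3

/-- Sequence (b), with `(a, b, c) = (11, 3, -1)`. -/
def seqB (n : ℕ) : ℤ :=
  ∑ k ∈ Finset.range (n + 1), (n.choose k : ℤ) ^ 2 * ((n + k).choose n : ℤ)

/-- Sequence (c), with `(a, b, c) = (10, 3, 9)`. -/
def seqC (n : ℕ) : ℤ :=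
  ∑ k ∈ Finset.range (n + 1), (n.choose k : ℤ) ^ 2 * ((2 * k).choose k : ℤ)

/-- Sequence (d), with `(a, b, c) = (12, 4, 32)`. -/
def seqD (n : ℕ) : ℤ :=
  ∑ k ∈ Finset.range (n + 1),
    (n.choose k : ℤ) * ((2 * k).choose k : ℤ) * ((2 * (n - k)).choose (n - k) : ℤ)

/-- Sequence (f), with `(a, b, c) = (9, 3, 27)`. Terms with `3 * k > n` vanish because of the
binomial coefficient. -/
def seqF (n : ℕ) : ℤ :=
  ∑ k ∈ Finset.range (n + 1),
    (-1 : ℤ) ^ k * 3 ^ (n - 3 * k) * (n.choose (3 * k) : ℤ) * (((3 * k)! / k ! ^ 3 : ℕ) : ℤ)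

/-- Sequence (g), with `(a, b, c) = (17, 6, 72)`. -/
def seqG (n : ℕ) : ℤ :=
  ∑ k ∈ Finset.range (n + 1), ∑ l ∈ Finset.range (n + 1),
    (-1 : ℤ) ^ k * 8 ^ (n - k) * (n.choose k : ℤ) * (k.choose l : ℤ) ^ 3

/-! Solutions of
`(n + 1)³ u (n + 1) = (2 n + 1) (a n² + a n + b) u n - n (c n² + d) u (n - 1)`, `u 0 = 1`. -/

/-- Sequence (δ), with `(a, b, c, d) = (7, 3, 81, 0)`. -/
def seqDelta (n : ℕ) : ℤ :=
  ∑ k ∈ Finset.range (n + 1),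
    (-1 : ℤ) ^ k * 3 ^ (n - 3 * k) * (n.choose (3 * k) : ℤ) * ((n + k).choose n : ℤ)
      * (((3 * k)! / k ! ^ 3 : ℕ) : ℤ)

/-- Sequence (η), with `(a, b, c, d) = (11, 5, 125, 0)`. The initial value is `1`; for `n ≥ 1` and
`k ≤ n / 5` one has `5 * k + 1 ≤ 4 * n`, so the natural-number subtractions do not truncate. -/
def seqEta (n : ℕ) : ℤ :=
  if n = 0 then 1
  else ∑ k ∈ Finset.range (n / 5 + 1),
    (-1 : ℤ) ^ k * (n.choose k : ℤ) ^ 3 *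
      (((4 * n - 5 * k - 1).choose (3 * n) : ℤ) + ((4 * n - 5 * k).choose (3 * n) : ℤ))

/-- Sequence (α), with `(a, b, c, d) = (10, 4, 64, 0)`. -/
def seqAlpha (n : ℕ) : ℤ :=
  ∑ k ∈ Finset.range (n + 1),
    (n.choose k : ℤ) ^ 2 * ((2 * k).choose k : ℤ) * ((2 * (n - k)).choose (n - k) : ℤ)

/-- Sequence (ε), with `(a, b, c, d) = (12, 4, 16, 0)`. -/
def seqEpsilon (n : ℕ) : ℤ :=
  ∑ k ∈ Finset.range (n + 1), (n.choose k : ℤ) ^ 2 * ((2 * k).choose n : ℤ) ^ 2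

/-- Sequence (ζ), with `(a, b, c, d) = (9, 3, -27, 0)`. -/
def seqZeta (n : ℕ) : ℤ :=
  ∑ k ∈ Finset.range (n + 1), ∑ l ∈ Finset.range (n + 1),
    (n.choose k : ℤ) ^ 2 * (n.choose l : ℤ) * (k.choose l : ℤ) * ((k + l).choose n : ℤ)

/-- Sequence (γ), the Apéry numbers, with `(a, b, c, d) = (17, 5, 1, 0)`. -/
def seqGamma (n : ℕ) : ℤ :=
  ∑ k ∈ Finset.range (n + 1), (n.choose k : ℤ) ^ 2 * ((n + k).choose n : ℤ) ^ 2

/-- Cooper's sequence `s₇`, with `(a, b, c, d) = (13, 4, -27, 3)`. -/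
def s7 (n : ℕ) : ℤ :=
  ∑ k ∈ Finset.range (n + 1),
    (n.choose k : ℤ) ^ 2 * ((n + k).choose k : ℤ) * ((2 * k).choose n : ℤ)

/-- Cooper's sequence `s₁₀`, with `(a, b, c, d) = (6, 2, -64, 4)`. -/
def s10 (n : ℕ) : ℤ := ∑ k ∈ Finset.range (n + 1), (n.choose k : ℤ) ^ 4

/-- Cooper's sequence `s₁₈`, with `(a, b, c, d) = (14, 6, 192, -12)`. The initial value is `1`; for
`n ≥ 1` and `k ≤ n / 3` one has `3 * k + 1 ≤ 2 * n`, so the natural-number subtractions do not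
truncate. -/
def s18 (n : ℕ) : ℤ :=
  if n = 0 then 1
  else ∑ k ∈ Finset.range (n / 3 + 1),
    (-1 : ℤ) ^ k * (n.choose k : ℤ) * ((2 * k).choose k : ℤ) *
      ((2 * (n - k)).choose (n - k) : ℤ) *
      (((2 * n - 3 * k - 1).choose n : ℤ) + ((2 * n - 3 * k).choose n : ℤ))

end AperyLike

/-! It suffices to peel off the lowest digit: a(n + pm) = a(n)a(m) mod p for n < p. For thirteen
sequences the summand itself splits along the digits of n and k, by Lucas' theorem and the vanishing
of binomials when a carry occurs; summing gives the claim (`LucasAt₂.lucasAt_sum`).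

For η and s₁₈ (s = 3, 1) the summands do not split. Reflecting k ↦ n - k merges the two binomials
into one with possibly negative upper entry, so the value is the coefficient of X^(sn) in A_n = ∑
(-1)^k w(n,k) (1+X)^((s+1)n-(s+2)k). Modulo p, A_{n+pm}(X) = A_n(X) A_m(X^p). In the coefficient of
X^(sn+psm), the term with j = sm is the desired product (`coeff_mul_expand`). The terms with j < sm
cancel, since A_n is sign-periodic beyond X^(sn) and A_m has a reflection symmetry. The term j = sm
+ 1 vanishes by the same symmetry. Terms with j ≥ sm + 2 do not occur for s = 1, and vanish by
finite differences for s = 3. -/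

open Finset PowerSeries

/-! ### Sequences multiplicative along base-p digits. -/

section Lucas

variable {R : Type*} [CommRing R]

/-- A sequence is multiplicative along the lowest base-`p` digit. -/
def LucasAt (p : ℕ) (a : ℕ → R) : Prop :=
  ∀ n < p, ∀ m, a (n + p * m) = a n * a m

/-- A double sequence is multiplicative along the lowest base-`p` digits. -/
def LucasAt₂ (p : ℕ) (F : ℕ → ℕ → R) : Prop :=
  ∀ n < p, ∀ k < p, ∀ m j, F (n + p * m) (k + p * j) = F n k * F m j

theorem satisfiesLucasCongruences_of_lucasAt {a : ℕ → ℤ}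
    (h : ∀ p : ℕ, p.Prime → LucasAt p (fun n => (a n : ZMod p))) :
    SatisfiesLucasCongruences a := by
  intro p hp r
  induction r with
  | zero =>
    intro n d _ hn
    simp only [zero_add, sum_range_one, pow_zero, mul_one] at hn
    simp [hn]
  | succ r ih =>
    intro n d hd hn
    have hn' : n = d 0 + p * ∑ i ∈ range (r + 1), d (i + 1) * p ^ i := by
      rw [hn, sum_range_succ', mul_sum, add_comm]
      simp only [pow_zero, mul_one]
      congr 1
      exact sum_congr rfl fun i _ => by ring
    have h1 := ih _ (fun i => d (i + 1)) (fun i hi => hd (i + 1) (by omega)) rfl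
    have h2 := h p hp (d 0) (hd 0 (by omega)) (∑ i ∈ range (r + 1), d (i + 1) * p ^ i)
    rw [← ZMod.intCast_eq_intCast_iff] at h1 ⊢
    simp only at h2
    rw [hn', h2, h1, prod_range_succ' _ (r + 1), Int.cast_mul, mul_comm]

theorem Finset.sum_range_mul_eq {M : Type*} [AddCommMonoid M] (f : ℕ → M) (p m : ℕ) :
    ∑ k ∈ range (p * m), f k = ∑ j ∈ range m, ∑ k ∈ range p, f (k + p * j) := by
  induction m with
  | zero => simp
  | succ m ih =>
    rw [sum_range_succ, ← ih, Nat.mul_succ, sum_range_add]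
    congr 1
    exact sum_congr rfl fun k _ => by rw [add_comm]

theorem sum_range_eq_mul_of_digits {p n m : ℕ} (f g h : ℕ → R) (hn : n < p)
    (hf : ∀ k, n + p * m < k → f k = 0) (hg : ∀ k < p, n < k → g k = 0)
    (H : ∀ k < p, ∀ j, f (k + p * j) = g k * h j) :
    ∑ k ∈ range (n + p * m + 1), f k
      = (∑ k ∈ range (n + 1), g k) * ∑ j ∈ range (m + 1), h j := by
  have h1 : ∑ k ∈ range (n + p * m + 1), f k = ∑ k ∈ range (p * (m + 1)), f k := by
    refine sum_subset (range_subset_range.2 (by nlinarith)) fun k _ hk => hf k ?_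
    simp only [mem_range] at hk; omega
  have h2 : ∑ k ∈ range (n + 1), g k = ∑ k ∈ range p, g k := by
    refine sum_subset (range_subset_range.2 (by omega)) fun k hk hk' => hg k ?_ ?_
    all_goals simp only [mem_range] at hk hk'; omega
  rw [h1, h2, Finset.sum_range_mul_eq, sum_mul_sum, sum_comm]
  exact sum_congr rfl fun k hk => sum_congr rfl fun j _ => H k (mem_range.1 hk) j

theorem LucasAt₂.lucasAt_sum {p : ℕ} {F : ℕ → ℕ → R} (hF : LucasAt₂ p F)
    (h0 : ∀ n k, n < k → F n k = 0) :
    LucasAt p (fun n => ∑ k ∈ range (n + 1), F n k) := fun n hn m =>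
  sum_range_eq_mul_of_digits _ _ _ hn (fun k => h0 _ k) (fun k _ => h0 n k)
    fun k hk j => hF n hn k hk m j

theorem LucasAt₂.mul {p : ℕ} {F G : ℕ → ℕ → R} (hF : LucasAt₂ p F) (hG : LucasAt₂ p G) :
    LucasAt₂ p (fun n k => F n k * G n k) := fun n hn k hk m j => by
  simp only [hF n hn k hk m j, hG n hn k hk m j]
  ring

theorem LucasAt₂.pow {p : ℕ} {F : ℕ → ℕ → R} (hF : LucasAt₂ p F) (e : ℕ) :
    LucasAt₂ p (fun n k => F n k ^ e) := fun n hn k hk m j => by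
  simp only [hF n hn k hk m j, mul_pow]

theorem LucasAt.left {p : ℕ} {a : ℕ → R} (ha : LucasAt p a) :
    LucasAt₂ p (fun n _ => a n) := fun n hn _ _ m _ => ha n hn m

theorem LucasAt.right {p : ℕ} {a : ℕ → R} (ha : LucasAt p a) :
    LucasAt₂ p (fun _ k => a k) := fun _ _ k hk _ j => ha k hk j

theorem LucasAt₂.diag {p : ℕ} {F : ℕ → ℕ → R} (hF : LucasAt₂ p F) :
    LucasAt p (fun n => F n n) := fun n hn m => hF n hn n hn m m

end Lucas

/-! ### Binomial coefficients modulo p. -/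

section Binomials

variable {p : ℕ} [hp : Fact p.Prime]

theorem lucasAt₂_choose : LucasAt₂ p (fun n k => (n.choose k : ZMod p)) := by
  intro n hn k hk m j
  have h := Choose.choose_modEq_choose_mod_mul_choose_div_nat (n := n + p * m) (k := k + p * j)
    (p := p)
  rw [← ZMod.natCast_eq_natCast_iff] at h
  have h0 := hp.out.pos
  simp only [Nat.add_mul_mod_self_left, Nat.mod_eq_of_lt hn, Nat.mod_eq_of_lt hk,
    Nat.add_mul_div_left _ _ h0, Nat.div_eq_of_lt hn, Nat.div_eq_of_lt hk, zero_add] at h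
  simpa using h

/-- The low digit of the upper entry is n - p < k, so a Lucas factor vanishes. -/
theorem choose_eq_zero_of_carry {n k : ℕ} (h1 : p ≤ n) (hk : k < p) (h2 : n < k + p) (m j : ℕ) :
    ((n + p * m).choose (k + p * j) : ZMod p) = 0 := by
  have h := lucasAt₂_choose (p := p) (n - p) (by omega) k hk (m + 1) j
  have e : n - p + p * (m + 1) = n + p * m := by rw [mul_add]; omega
  simp only [e] at h
  rw [h, Nat.choose_eq_zero_of_lt (by omega : n - p < k)]
  simp

theorem lucasAt₂_choose_add : LucasAt₂ p (fun n k => ((n + k).choose k : ZMod p)) := by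
  intro n hn k hk m j
  have e : n + p * m + (k + p * j) = (n + k) + p * (m + j) := by ring
  simp only [e]
  by_cases h : n + k < p
  · exact lucasAt₂_choose _ h k hk _ _
  · have h0 := choose_eq_zero_of_carry (p := p) (n := n + k) (not_lt.1 h) hk (by omega) 0 0
    simp only [mul_zero, add_zero] at h0
    rw [choose_eq_zero_of_carry (not_lt.1 h) hk (by omega), h0, zero_mul]

theorem lucasAt₂_choose_add' : LucasAt₂ p (fun n k => ((n + k).choose n : ZMod p)) := by
  convert lucasAt₂_choose_add (p := p) using 4
  exact Nat.choose_symm_add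

theorem lucasAt_centralBinom : LucasAt p (fun n => ((2 * n).choose n : ZMod p)) := by
  simpa only [two_mul] using (lucasAt₂_choose_add (p := p)).diag

/-- The second binomial alone does not split; the first forces k ≤ n, so that 2k ≥ p implies 2k - p
< n and both sides vanish. -/
theorem lucasAt₂_choose_mul_choose_two_mul :
    LucasAt₂ p (fun n k => (n.choose k * (2 * k).choose n : ZMod p)) := by
  intro n hn k hk m j
  simp only [lucasAt₂_choose n hn k hk m j]
  rcases lt_or_ge n k with hkn | hkn
  · simp [Nat.choose_eq_zero_of_lt hkn]
  have e : 2 * (k + p * j) = 2 * k + p * (2 * j) := by ring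
  simp only [e]
  by_cases h : 2 * k < p
  · simp only [lucasAt₂_choose _ h n hn _ _]; ring
  · have h0 := choose_eq_zero_of_carry (p := p) (n := 2 * k) (not_lt.1 h) hn (by omega) 0 0
    simp only [mul_zero, add_zero] at h0
    rw [choose_eq_zero_of_carry (not_lt.1 h) hn (by omega), h0]; ring

theorem lucasAt_pow (c : ZMod p) : LucasAt p (fun n => c ^ n) := fun n _ m => by
  simp only [pow_add, pow_mul, ZMod.pow_card]

/-- The binomial kills every case in which n - k would borrow between digits or truncate. -/
theorem LucasAt₂.choose_mul_sub {G : ℕ → ℕ → ZMod p} (hG : LucasAt₂ p G) :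
    LucasAt₂ p (fun n k => n.choose k * G (n - k) k) := by
  intro n hn k hk m j
  simp only [lucasAt₂_choose n hn k hk m j]
  rcases lt_or_ge n k with hkn | hkn
  · simp [Nat.choose_eq_zero_of_lt hkn]
  rcases lt_or_ge m j with hjm | hjm
  · simp [Nat.choose_eq_zero_of_lt hjm]
  have e : n + p * m - (k + p * j) = (n - k) + p * (m - j) := by
    have := Nat.mul_le_mul_left p hjm
    rw [Nat.mul_sub]; omega
  rw [e, hG _ (by omega) k hk]
  ring

end Binomials

/-! ### The thirteen sequences that split term by term. -/

namespace AperyLike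

/-- Both sides are n!/(k!³(n-3k)!); the right side suits three uses of `LucasAt₂.choose_mul_sub`. -/
theorem choose_mul_factorial_div (n k : ℕ) :
    n.choose (3 * k) * ((3 * k)! / k ! ^ 3)
      = n.choose k * ((n - k).choose k * (n - k - k).choose k) := by
  rcases lt_or_ge n (3 * k) with h | h
  · rw [Nat.choose_eq_zero_of_lt h]
    rcases lt_or_ge n k with h1 | h1
    · simp [Nat.choose_eq_zero_of_lt h1]
    rcases lt_or_ge (n - k) k with h2 | h2
    · simp [Nat.choose_eq_zero_of_lt h2]
    · simp [Nat.choose_eq_zero_of_lt (by omega : n - k - k < k)]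
  obtain ⟨q, hq⟩ := factorial_pow_three_dvd k
  have hk : 0 < k ! ^ 3 := by positivity
  rw [hq, Nat.mul_div_cancel_left _ hk]
  have h0 := Nat.choose_mul_factorial_mul_factorial h
  have h1 := Nat.choose_mul_factorial_mul_factorial (by omega : k ≤ n)
  have h2 := Nat.choose_mul_factorial_mul_factorial (by omega : k ≤ n - k)
  have h3 := Nat.choose_mul_factorial_mul_factorial (by omega : k ≤ n - k - k)
  have e : n - k - k - k = n - 3 * k := by omega
  rw [e] at h3
  have hpos : 0 < k ! ^ 3 * (n - 3 * k)! := by positivity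
  apply Nat.eq_of_mul_eq_mul_right hpos
  calc _ = n.choose (3 * k) * (k ! ^ 3 * q) * (n - 3 * k)! := by ring
    _ = n ! := by rw [← hq, h0]
    _ = _ := by rw [← h1, ← h2, ← h3]; ring

end AperyLike

namespace AperyLike

variable {p : ℕ} [hp : Fact p.Prime]

theorem lucasAt_seqA : LucasAt p (fun n => (seqA n : ZMod p)) := by
  have h := (lucasAt₂_choose (p := p).pow 3).lucasAt_sum
    fun n k h => by simp [Nat.choose_eq_zero_of_lt h]
  simpa [seqA] using h

theorem lucasAt_seqB : LucasAt p (fun n => (seqB n : ZMod p)) := by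
  have h := ((lucasAt₂_choose (p := p).pow 2).mul lucasAt₂_choose_add').lucasAt_sum
    fun n k h => by simp [Nat.choose_eq_zero_of_lt h]
  simpa [seqB] using h

theorem lucasAt_seqC : LucasAt p (fun n => (seqC n : ZMod p)) := by
  have h := ((lucasAt₂_choose (p := p).pow 2).mul lucasAt_centralBinom.right).lucasAt_sum
    fun n k h => by simp [Nat.choose_eq_zero_of_lt h]
  simpa [seqC] using h

theorem lucasAt₂_choose_mul_centralBinom_mul_centralBinom :
    LucasAt₂ p (fun n k => (n.choose k * ((2 * (n - k)).choose (n - k) * (2 * k).choose k) :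
      ZMod p)) :=
  (lucasAt_centralBinom.left.mul lucasAt_centralBinom.right).choose_mul_sub

theorem lucasAt_seqD : LucasAt p (fun n => (seqD n : ZMod p)) := by
  have h := (lucasAt₂_choose_mul_centralBinom_mul_centralBinom (p := p)).lucasAt_sum
    fun n k h => by simp [Nat.choose_eq_zero_of_lt h]
  simpa [seqD, mul_assoc, mul_comm, mul_left_comm] using h

theorem lucasAt₂_seqF_term : LucasAt₂ p (fun n k =>
    ((-1 : ZMod p) ^ k * 3 ^ (n - 3 * k) * n.choose (3 * k) * ((3 * k)! / k ! ^ 3 : ℕ))) := by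
  have h := (lucasAt_pow (-1 : ZMod p)).right.mul
    (lucasAt_pow (3 : ZMod p)).left.choose_mul_sub.choose_mul_sub.choose_mul_sub
  convert h using 3 with n k
  rw [mul_assoc _ (n.choose (3 * k) : ZMod p), ← Nat.cast_mul, choose_mul_factorial_div,
    (by omega : n - 3 * k = n - k - k - k)]
  push_cast
  ring

theorem lucasAt_seqF : LucasAt p (fun n => (seqF n : ZMod p)) := by
  have h := (lucasAt₂_seqF_term (p := p)).lucasAt_sum
    fun n k h => by simp [Nat.choose_eq_zero_of_lt (by omega : n < 3 * k)]
  simpa only [seqF, Int.cast_sum, Int.cast_mul, Int.cast_pow, Int.cast_neg, Int.cast_one,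
    Int.cast_ofNat, Int.cast_natCast] using h

theorem lucasAt_seqDelta : LucasAt p (fun n => (seqDelta n : ZMod p)) := by
  have h := ((lucasAt₂_seqF_term (p := p)).mul lucasAt₂_choose_add').lucasAt_sum
    fun n k h => by simp [Nat.choose_eq_zero_of_lt (by omega : n < 3 * k)]
  simpa only [seqDelta, Int.cast_sum, Int.cast_mul, Int.cast_pow, Int.cast_neg, Int.cast_one,
    Int.cast_ofNat, Int.cast_natCast, mul_right_comm] using h

theorem lucasAt_seqG : LucasAt p (fun n => (seqG n : ZMod p)) := by
  have h := ((lucasAt_pow (-1 : ZMod p)).right.mul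
    ((lucasAt_pow (8 : ZMod p)).left.choose_mul_sub.mul lucasAt_seqA.right)).lucasAt_sum
    fun n k h => by simp [Nat.choose_eq_zero_of_lt h]
  convert h using 2 with n
  rw [seqG, Int.cast_sum]
  refine sum_congr rfl fun k hk => ?_
  rw [← mul_sum]
  have e : ∑ l ∈ range (n + 1), (k.choose l : ℤ) ^ 3 = seqA k := by
    refine (sum_subset (range_subset_range.2 (by simp at hk; omega)) fun l _ hl => ?_).symm
    rw [Nat.choose_eq_zero_of_lt (by simp at hl; omega)]; simp
  rw [e]
  push_cast
  ring

theorem lucasAt_seqAlpha : LucasAt p (fun n => (seqAlpha n : ZMod p)) := by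
  have h := (lucasAt₂_choose.mul
    (lucasAt₂_choose_mul_centralBinom_mul_centralBinom (p := p))).lucasAt_sum
    fun n k h => by simp [Nat.choose_eq_zero_of_lt h]
  simpa [seqAlpha, sq, mul_assoc, mul_comm, mul_left_comm] using h

theorem lucasAt_seqEpsilon : LucasAt p (fun n => (seqEpsilon n : ZMod p)) := by
  have h := (lucasAt₂_choose_mul_choose_two_mul (p := p).pow 2).lucasAt_sum
    fun n k h => by simp [Nat.choose_eq_zero_of_lt h]
  simpa [seqEpsilon, mul_pow] using h

theorem lucasAt_seqGamma : LucasAt p (fun n => (seqGamma n : ZMod p)) := by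
  have h := ((lucasAt₂_choose (p := p).mul lucasAt₂_choose_add').pow 2).lucasAt_sum
    fun n k h => by simp [Nat.choose_eq_zero_of_lt h]
  simpa [seqGamma, mul_pow] using h

theorem lucasAt_s7 : LucasAt p (fun n => (s7 n : ZMod p)) := by
  have h := ((lucasAt₂_choose (p := p).mul lucasAt₂_choose_add).mul
    lucasAt₂_choose_mul_choose_two_mul).lucasAt_sum
    fun n k h => by simp [Nat.choose_eq_zero_of_lt h]
  simpa [s7, sq, mul_assoc, mul_comm, mul_left_comm] using h

theorem lucasAt_s10 : LucasAt p (fun n => (s10 n : ZMod p)) := by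
  have h := (lucasAt₂_choose (p := p).pow 4).lucasAt_sum
    fun n k h => by simp [Nat.choose_eq_zero_of_lt h]
  simpa [s10] using h

theorem lucasAt_seqZeta : LucasAt p (fun n => (seqZeta n : ZMod p)) := by
  have h : LucasAt₂ p (fun n k => (n.choose k : ZMod p) ^ 2 * ∑ l ∈ range (n + 1),
      (n.choose l * k.choose l * (k + l).choose n : ZMod p)) := by
    intro n hn k hk m j
    simp only [lucasAt₂_choose n hn k hk m j]
    rcases lt_or_ge n k with hkn | hkn
    · simp [Nat.choose_eq_zero_of_lt hkn]
    -- With k ≤ n in hand, the inner sum over l splits along digits as well.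
    rw [sum_range_eq_mul_of_digits _
      (fun l => (n.choose l * k.choose l * (k + l).choose n : ZMod p))
      (fun l => (m.choose l * j.choose l * (j + l).choose m : ZMod p)) hn
      (fun l hl => by simp [Nat.choose_eq_zero_of_lt hl])
      (fun l _ hl => by simp [Nat.choose_eq_zero_of_lt hl]), mul_pow]
    · ring
    intro l hl i
    simp only [lucasAt₂_choose n hn l hl m i, lucasAt₂_choose k hk l hl j i]
    rcases lt_or_ge n l with hln | hln
    · simp [Nat.choose_eq_zero_of_lt hln]
    have e : k + p * j + (l + p * i) = (k + l) + p * (j + i) := by ring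
    rw [e]
    by_cases h : k + l < p
    · simp only [lucasAt₂_choose _ h n hn _ _]; ring
    · have h0 := choose_eq_zero_of_carry (p := p) (n := k + l) (not_lt.1 h) hn (by omega) 0 0
      simp only [mul_zero, add_zero] at h0
      rw [choose_eq_zero_of_carry (not_lt.1 h) hn (by omega), h0]; ring
  convert h.lucasAt_sum (fun n k h => by simp [Nat.choose_eq_zero_of_lt h]) using 2 with n
  rw [seqZeta]
  push_cast
  refine sum_congr rfl fun k _ => ?_
  rw [mul_sum]
  exact sum_congr rfl fun l _ => by ring

end AperyLike

/-! ### Binomial series modulo p and coefficient extraction. -/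

theorem Ring.choose_neg_sub_int (x : ℤ) (b : ℕ) :
    Ring.choose ((b : ℤ) - 1 - x) b = (-1) ^ b * Ring.choose x b := by
  have h := Ring.choose_neg (x - b + 1) b
  rw [Units.smul_def, Int.coe_negOnePow_natCast, smul_eq_mul] at h
  rw [← (by ring : -(x - b + 1) = (b : ℤ) - 1 - x), h]
  congr 2
  ring

section Series

variable {p : ℕ} [hp : Fact p.Prime]

/-- Frobenius gives (1+X)^p = 1+X^p; negative exponents follow because binomial series are
invertible. -/
theorem binomialSeries_natCast_mul (a : ℤ) :
    binomialSeries (ZMod p) ((p : ℤ) * a)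
      = expand p hp.out.ne_zero (binomialSeries (ZMod p) a) := by
  have hnat (a : ℕ) : binomialSeries (ZMod p) ((p : ℤ) * a)
      = expand p hp.out.ne_zero (binomialSeries (ZMod p) (a : ℤ)) := by
    have : CharP (ZMod p)⟦X⟧ p := charP_of_injective_algebraMap (C_injective (R := ZMod p)) p
    rw [← Nat.cast_mul, binomialSeries_nat, binomialSeries_nat, pow_mul, add_pow_char]
    simp
  obtain ⟨c, d, rfl⟩ : ∃ c d : ℕ, a = c - d := ⟨a.toNat, (-a).toNat, by omega⟩
  have hinv (r : ℤ) : binomialSeries (ZMod p) r * binomialSeries (ZMod p) (-r) = 1 := by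
    rw [← binomialSeries_add, add_neg_cancel, binomialSeries_zero]
  have h1 : binomialSeries (ZMod p) ((p : ℤ) * (c - d)) * binomialSeries (ZMod p) ((p : ℤ) * d)
      = expand p hp.out.ne_zero (binomialSeries (ZMod p) (c - d : ℤ))
        * binomialSeries (ZMod p) ((p : ℤ) * d) := by
    rw [← binomialSeries_add, hnat d, ← map_mul, ← binomialSeries_add, sub_add_cancel, ← hnat]
    congr 1
    ring
  have h2 := congrArg (· * binomialSeries (ZMod p) (-((p : ℤ) * d))) h1
  simpa only [mul_assoc, hinv, mul_one] using h2

/-- Up to the sign (-1)^n, binom(-c, n) is binom(n+c-1, c-1), which depends only on n mod p because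
c - 1 is a single digit. -/
theorem choose_neg_add_mul {c : ℕ} (hc : 1 ≤ c) (hcp : c ≤ p) (b t : ℕ) :
    ((Ring.choose (-(c : ℤ)) (b + p * t) : ℤ) : ZMod p)
      = (-1) ^ t * ((Ring.choose (-(c : ℤ)) b : ℤ) : ZMod p) := by
  obtain ⟨c, rfl⟩ := Nat.exists_eq_add_of_le' hc
  have key (n : ℕ) : ((Ring.choose (-((c + 1 : ℕ) : ℤ)) n : ℤ) : ZMod p)
      = (-1) ^ n * ((n + c).choose c : ZMod p) := by
    rw [Ring.choose_neg, Units.smul_def, Int.coe_negOnePow_natCast, smul_eq_mul,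
      (by push_cast; ring : ((c + 1 : ℕ) : ℤ) + n - 1 = ((n + c : ℕ) : ℤ)), Ring.choose_natCast,
      Nat.choose_symm_add]
    push_cast
    ring
  have hadd (n : ℕ) : ((n + c).choose c : ZMod p) = ((n % p + c).choose c : ZMod p) := by
    have h := lucasAt₂_choose_add (n % p) (Nat.mod_lt _ hp.out.pos) c hcp (n / p) 0
    simp only [Nat.mod_add_div] at h
    simpa using h
  rw [key, key, hadd, hadd b, Nat.add_mul_mod_self_left, pow_add, pow_mul, ZMod.pow_card]
  ring

theorem coeff_mul_expand {f g : (ZMod p)⟦X⟧} {b M : ℕ} (e : ZMod p)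
    (hneg : ∀ t, 1 ≤ t → coeff (b + p * t) f = (-1) ^ t * e)
    (hpos : ∀ i, 1 ≤ i → p * i ≤ b → coeff (b - p * i) f * coeff (M + i) g = 0)
    (hg : coeff M (g * binomialSeries (ZMod p) (-1 : ℤ)) = coeff M g) :
    coeff (b + p * M) (f * expand p hp.out.ne_zero g) = coeff b f * coeff M g := by
  have hp0 := hp.out.pos
  have h1 : coeff (b + p * M) (f * expand p hp.out.ne_zero g)
      = ∑ j ∈ range (b / p + M + 1), coeff (b + p * M - p * j) f * coeff j g := by
    rw [mul_comm f, coeff_mul, Nat.sum_antidiagonal_eq_sum_range_succ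
      (fun i j => coeff i (expand p hp.out.ne_zero g) * coeff j f)]
    have : ∑ j ∈ range (b / p + M + 1), coeff (b + p * M - p * j) f * coeff j g
        = ∑ k ∈ (range (b / p + M + 1)).image (p * ·),
          coeff k (expand p hp.out.ne_zero g) * coeff (b + p * M - k) f := by
      rw [sum_image fun x _ y _ h => Nat.eq_of_mul_eq_mul_left hp0 h]
      exact sum_congr rfl fun j _ => by rw [coeff_expand_mul, mul_comm]
    rw [this]
    refine (sum_subset ?_ fun k hk hk' => ?_).symm
    · intro k hk
      simp only [mem_image, mem_range] at hk ⊢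
      obtain ⟨j, hj, rfl⟩ := hk
      have h2 : p * j ≤ p * (b / p + M) := Nat.mul_le_mul_left p (by omega)
      have := Nat.mul_div_le b p
      rw [mul_add] at h2
      omega
    · rw [coeff_expand_of_not_dvd, zero_mul]
      rintro ⟨j, rfl⟩
      apply hk'
      simp only [mem_image, mem_range] at hk ⊢
      refine ⟨j, ?_, rfl⟩
      have : (p * j) / p ≤ (b + p * M) / p := Nat.div_le_div_right (by omega)
      rw [Nat.mul_div_cancel_left _ hp0, Nat.add_mul_div_left _ _ hp0] at this
      omega
  -- The series of exponent -1 is ∑ (-X)^n, so `hg` says that the alternating sum of the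
  -- coefficients of g below M vanishes.
  have hsum : ∑ j ∈ range M, (-1) ^ (M - j) * coeff j g = 0 := by
    rw [coeff_mul, Nat.sum_antidiagonal_eq_sum_range_succ
      (fun i j => coeff i g * coeff j (binomialSeries (ZMod p) (-1 : ℤ))), sum_range_succ] at hg
    have hc (n : ℕ) : coeff n (binomialSeries (ZMod p) (-1 : ℤ)) = (-1) ^ n := by
      have h := Ring.choose_neg (1 : ℤ) n
      rw [Units.smul_def, Int.coe_negOnePow_natCast, smul_eq_mul, add_sub_cancel_left,
        Ring.choose_natCast, Nat.choose_self] at h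
      simp [binomialSeries_coeff, h]
    simp only [hc, Nat.sub_self, pow_zero, mul_one, add_eq_right] at hg
    simpa only [mul_comm] using hg
  rw [h1, (by ring : b / p + M + 1 = M + 1 + b / p), sum_range_add, sum_range_succ,
    sum_eq_zero (s := range (b / p)), add_zero, Nat.add_sub_cancel]
  · rw [add_eq_right]
    calc _ = ∑ j ∈ range M, e * ((-1) ^ (M - j) * coeff j g) := by
          refine sum_congr rfl fun j hj => ?_
          rw [mem_range] at hj
          rw [Nat.add_sub_assoc (Nat.mul_le_mul_left p hj.le), ← Nat.mul_sub, hneg _ (by omega)]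
          ring
      _ = 0 := by rw [← mul_sum, hsum, mul_zero]
  · intro i hi
    rw [mem_range] at hi
    have h2 : p * (1 + i) ≤ b := (Nat.mul_le_mul_left p (by omega)).trans (Nat.mul_div_le b p)
    rw [← hpos (1 + i) (by omega) h2, add_assoc M 1 i, mul_add p M, Nat.add_comm (p * M),
      Nat.add_sub_add_right]

end Series

/-! ### Alternating sums and the reflection k ↦ n - k. -/

/-- The alternating sum `∑ (-1)ᵏ w(n, k) binom((s + 1) n - (s + 2) k, b)`, with binomial
coefficients extended to negative upper entries. -/
def alternatingChooseSum (w : ℕ → ℕ → ℤ) (s n b : ℕ) : ℤ :=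
  ∑ k ∈ range (n + 1), (-1) ^ k * w n k * Ring.choose ((s + 1) * n - (s + 2) * k : ℤ) b

section Symmetry

variable {w : ℕ → ℕ → ℤ} {s n : ℕ}

theorem neg_one_pow_sub_int {n k : ℕ} (h : k ≤ n) : (-1 : ℤ) ^ (n - k) = (-1) ^ n * (-1) ^ k := by
  obtain ⟨m, rfl⟩ := Nat.exists_eq_add_of_le h
  rw [Nat.add_sub_cancel_left, pow_add, mul_right_comm, ← mul_pow]
  simp

theorem sum_alternating_reflect (hw : ∀ k ≤ n, w n (n - k) = w n k) (f : ℕ → ℤ) :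
    ∑ k ∈ range (n + 1), (-1) ^ k * w n k * f k
      = (-1) ^ n * ∑ k ∈ range (n + 1), (-1) ^ k * w n k * f (n - k) := by
  rw [← sum_range_reflect, mul_sum]
  refine sum_congr rfl fun k hk => ?_
  have hk : k ≤ n := by simpa [Nat.lt_succ_iff] using hk
  rw [Nat.add_sub_cancel, hw k hk, neg_one_pow_sub_int hk]
  ring

theorem alternatingChooseSum_eq (hw : ∀ k ≤ n, w n (n - k) = w n k) (b : ℕ) :
    alternatingChooseSum w s n b = (-1) ^ (n + b) * ∑ k ∈ range (n + 1),
      (-1) ^ k * w n k * Ring.choose (b + n - 1 - (s + 2) * k : ℤ) b := by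
  rw [alternatingChooseSum,
    sum_alternating_reflect hw fun k => Ring.choose ((s + 1) * n - (s + 2) * k : ℤ) b, pow_add,
    mul_assoc]
  congr 1
  rw [mul_sum]
  refine sum_congr rfl fun k hk => ?_
  have hk : k ≤ n := by simpa [Nat.lt_succ_iff] using hk
  rw [(by push_cast [hk]; ring : ((s + 1) * n - (s + 2) * (n - k : ℕ) : ℤ)
    = b - 1 - (b + n - 1 - (s + 2) * k)), Ring.choose_neg_sub_int]
  ring

/-- At b = sn + 1 reflection returns the same sum with sign (-1)^((s+1)n+1) = -1. -/
theorem alternatingChooseSum_mul_add_one (hs : Odd s) (hw : ∀ k ≤ n, w n (n - k) = w n k) :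
    alternatingChooseSum w s n (s * n + 1) = 0 := by
  have h := alternatingChooseSum_eq (s := s) hw (s * n + 1)
  have e : Odd (n + (s * n + 1)) := by
    rw [(by ring : n + (s * n + 1) = (s + 1) * n + 1)]
    exact (hs.add_one.mul_right n).add_one
  have h2 : alternatingChooseSum w s n (s * n + 1) = ∑ k ∈ range (n + 1),
      (-1) ^ k * w n k * Ring.choose (((s * n + 1 : ℕ) : ℤ) + n - 1 - (s + 2) * k) (s * n + 1) := by
    refine sum_congr rfl fun k _ => ?_
    congr 2
    push_cast
    ring
  rw [← h2, e.neg_one_pow] at h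
  omega

/-- At b = sn reflection lowers each upper entry by one: dividing the generating series by 1 + X
preserves this coefficient. -/
theorem alternatingChooseSum_mul (hs : Odd s) (hw : ∀ k ≤ n, w n (n - k) = w n k) :
    alternatingChooseSum w s n (s * n) = ∑ k ∈ range (n + 1),
      (-1) ^ k * w n k * Ring.choose ((s + 1) * n - (s + 2) * k + -1 : ℤ) (s * n) := by
  have e : Even (n + s * n) := by
    rw [(by ring : n + s * n = (s + 1) * n)]
    exact hs.add_one.mul_right n
  rw [alternatingChooseSum_eq hw, e.neg_one_pow, one_mul]
  refine sum_congr rfl fun k _ => ?_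
  congr 2
  push_cast
  ring

theorem sum_range_ite_mul_le (f : ℕ → ℤ) (q n : ℕ) (hq : 0 < q) :
    ∑ k ∈ range (n + 1), (if q * k ≤ n then f k else 0) = ∑ k ∈ range (n / q + 1), f k := by
  rw [← sum_filter]
  congr 1
  ext k
  simp only [mem_filter, mem_range, Nat.lt_succ_iff, Nat.le_div_iff_mul_le hq, mul_comm k]
  exact and_iff_right_of_imp fun h => (Nat.le_mul_of_pos_left k hq).trans h

theorem sum_range_choose_add_choose (hs : Odd s) (hn : n ≠ 0)
    (hw : ∀ k ≤ n, w n (n - k) = w n k) :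
    ∑ k ∈ range (n / (s + 2) + 1), (-1) ^ k * w n k *
      ((((s + 1) * n - (s + 2) * k - 1).choose (s * n) : ℤ)
        + (((s + 1) * n - (s + 2) * k).choose (s * n) : ℤ))
      = alternatingChooseSum w s n (s * n) := by
  have hs0 : 0 < s := hs.pos
  have hsn : 0 < s * n := by positivity
  let g : ℕ → ℤ := fun k => if (s + 2) * k ≤ n then
    (((s + 1) * n - (s + 2) * k - 1).choose (s * n) : ℤ) else 0
  let h : ℕ → ℤ := fun k => if (s + 2) * k ≤ n then
    (((s + 1) * n - (s + 2) * k).choose (s * n) : ℤ) else 0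
  -- Upper entries in [0, sn) contribute 0; negative ones become, under upper negation, the
  -- binomials with the extra -1 at index n - k.
  have key : ∀ k ≤ n, Ring.choose ((s + 1) * n - (s + 2) * k : ℤ) (s * n)
      = h k + (-1) ^ n * g (n - k) := by
    intro k hk
    have e1 : (s + 2) * (n - k) + (s + 2) * k = s * n + 2 * n := by
      rw [← mul_add, Nat.sub_add_cancel hk]; ring
    have e2 : (s + 1) * n = s * n + n := by ring
    simp only [g, h]
    rcases le_or_gt ((s + 2) * k) ((s + 1) * n) with h1 | h1
    · have e3 : ((s + 1) * n - (s + 2) * k : ℤ) = (((s + 1) * n - (s + 2) * k : ℕ) : ℤ) := by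
        push_cast [h1]; ring
      rw [e3, Ring.choose_natCast]
      have hg : (if (s + 2) * (n - k) ≤ n then
          (((s + 1) * n - (s + 2) * (n - k) - 1).choose (s * n) : ℤ) else 0) = 0 := by
        split_ifs
        · rw [Nat.choose_eq_zero_of_lt (by omega)]; simp
        · rfl
      rw [hg]
      split_ifs
      · simp
      · rw [Nat.choose_eq_zero_of_lt (by omega)]; simp
    · rw [if_neg (by omega), if_pos (by omega)]
      have e3 : ((s + 1) * n - (s + 2) * k : ℤ)
          = ((s * n : ℕ) : ℤ) - 1 - (((s + 1) * n - (s + 2) * (n - k) - 1 : ℕ) : ℤ) := by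
        have : ((s + 1) * n - (s + 2) * (n - k) - 1 : ℕ) + 1 + n = (s + 2) * k := by omega
        have := congrArg (Nat.cast (R := ℤ)) this
        push_cast at this ⊢
        linarith
      rw [e3, Ring.choose_neg_sub_int, Ring.choose_natCast, pow_mul, hs.neg_one_pow, zero_add]
  have hsum : alternatingChooseSum w s n (s * n)
      = ∑ k ∈ range (n + 1), (-1) ^ k * w n k * h k
        + ∑ k ∈ range (n + 1), (-1) ^ k * w n k * g k := by
    rw [sum_alternating_reflect hw g, mul_sum, ← sum_add_distrib]
    refine sum_congr rfl fun k hk => ?_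
    rw [key k (by simpa [Nat.lt_succ_iff] using hk)]
    ring
  rw [hsum, ← sum_add_distrib, ← sum_range_ite_mul_le _ _ _ (by omega : 0 < s + 2)]
  refine sum_congr rfl fun k _ => ?_
  simp only [g, h]
  split_ifs <;> ring

end Symmetry

/-! ### Digit factorization of the generating series. -/

section Digits

variable {p : ℕ} [hp : Fact p.Prime] {w : ℕ → ℕ → ℤ} {s : ℕ}

/-- The generating function of `alternatingChooseSum w s n` modulo `p`. -/
noncomputable def alternatingChooseSeries (p : ℕ) (w : ℕ → ℕ → ℤ) (s n : ℕ) : (ZMod p)⟦X⟧ :=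
  ∑ k ∈ range (n + 1), C ((-1) ^ k * (w n k : ZMod p)) *
    binomialSeries (ZMod p) ((s + 1) * n - (s + 2) * k : ℤ)

theorem coeff_alternatingChooseSeries (n b : ℕ) :
    coeff b (alternatingChooseSeries p w s n) = (alternatingChooseSum w s n b : ZMod p) := by
  simp only [alternatingChooseSeries, alternatingChooseSum, map_sum, coeff_C_mul,
    binomialSeries_coeff, zsmul_one]
  push_cast
  rfl

theorem alternatingChooseSeries_add_mul (hw : LucasAt₂ p fun n k => (w n k : ZMod p))
    (h0 : ∀ n k, n < k → w n k = 0) {n : ℕ} (hn : n < p) (m : ℕ) :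
    alternatingChooseSeries p w s (n + p * m) = alternatingChooseSeries p w s n
      * expand p hp.out.ne_zero (alternatingChooseSeries p w s m) := by
  simp only [alternatingChooseSeries, map_sum]
  refine sum_range_eq_mul_of_digits _ _ _ hn (fun k hk => by simp [h0 _ k hk])
    (fun k _ hk => by simp [h0 _ k hk]) fun k hk j => ?_
  have e : ((s + 1) * (n + p * m : ℕ) - (s + 2) * (k + p * j : ℕ) : ℤ)
      = ((s + 1) * n - (s + 2) * k) + p * ((s + 1) * m - (s + 2) * j) := by
    push_cast; ring
  have h := hw n hn k hk m j
  simp only at h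
  rw [e, binomialSeries_add, binomialSeries_natCast_mul, h, map_mul (expand p _), expand_C, pow_add,
    pow_mul,
    ZMod.pow_card]
  simp only [map_mul]
  ring

/-- Nonnegative exponents are at most sn + n < sn + p and contribute nothing; negative ones are at
least -n, where `choose_neg_add_mul` applies. -/
theorem exists_coeff_alternatingChooseSeries_add_mul {n : ℕ} (hn : n < p) :
    ∃ e : ZMod p, ∀ t, 1 ≤ t →
      coeff (s * n + p * t) (alternatingChooseSeries p w s n) = (-1) ^ t * e := by
  refine ⟨∑ k ∈ range (n + 1), if (s + 1) * n < (s + 2) * k then (-1) ^ k * (w n k : ZMod p) *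
    ((Ring.choose ((s + 1) * n - (s + 2) * k : ℤ) (s * n) : ℤ) : ZMod p) else 0, fun t ht => ?_⟩
  rw [coeff_alternatingChooseSeries, alternatingChooseSum, Int.cast_sum, mul_sum]
  refine sum_congr rfl fun k hk => ?_
  have hk : k ≤ n := by simpa [Nat.lt_succ_iff] using hk
  have e2 : (s + 1) * n = s * n + n := by ring
  split_ifs with h
  · have hc : (s + 2) * k - (s + 1) * n ≤ n := by
      have : (s + 2) * k ≤ (s + 2) * n := Nat.mul_le_mul_left _ hk
      have : (s + 2) * n = s * n + 2 * n := by ring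
      omega
    have e3 : ((s + 1) * n - (s + 2) * k : ℤ) = -(((s + 2) * k - (s + 1) * n : ℕ) : ℤ) := by
      push_cast [h.le]; ring
    push_cast
    rw [e3, choose_neg_add_mul (by omega) (by omega)]
    ring
  · have e3 : ((s + 1) * n - (s + 2) * k : ℤ) = (((s + 1) * n - (s + 2) * k : ℕ) : ℤ) := by
      push_cast [not_lt.1 h]; ring
    have : p * 1 ≤ p * t := Nat.mul_le_mul_left p ht
    rw [e3, Ring.choose_natCast, Nat.choose_eq_zero_of_lt (by omega)]
    simp

theorem lucasAt_alternatingChooseSum (hs : Odd s) (hw : LucasAt₂ p fun n k => (w n k : ZMod p))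
    (h0 : ∀ n k, n < k → w n k = 0) (hsymm : ∀ n, ∀ k ≤ n, w n (n - k) = w n k)
    (hpos : ∀ n < p, ∀ i, 2 ≤ i → p * i ≤ s * n →
      (alternatingChooseSum w s n (s * n - p * i) : ZMod p) = 0) :
    LucasAt p (fun n => (alternatingChooseSum w s n (s * n) : ZMod p)) := by
  intro n hn m
  obtain ⟨e, he⟩ := exists_coeff_alternatingChooseSeries_add_mul (w := w) (s := s) hn
  simp only [← coeff_alternatingChooseSeries]
  rw [alternatingChooseSeries_add_mul hw h0 hn, (by ring : s * (n + p * m) = s * n + p * (s * m))]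
  refine coeff_mul_expand e he (fun i hi hin => ?_) ?_
  · simp only [coeff_alternatingChooseSeries]
    rcases hi.eq_or_lt with rfl | hi
    · rw [alternatingChooseSum_mul_add_one hs (hsymm m), Int.cast_zero, mul_zero]
    · rw [hpos n hn i hi hin, zero_mul]
  · rw [coeff_alternatingChooseSeries, alternatingChooseSum_mul hs (hsymm m)]
    simp only [alternatingChooseSeries, sum_mul, mul_assoc (C _), ← binomialSeries_add, map_sum,
      coeff_C_mul, binomialSeries_coeff, zsmul_one]
    push_cast
    rfl

end Digits

/-! ### Vanishing by finite differences. -/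

section Vanishing

variable {p : ℕ} [hp : Fact p.Prime]

theorem factorial_ne_zero_zmod {k : ℕ} (hk : k < p) : (k ! : ZMod p) ≠ 0 := by
  rw [Ne, ZMod.natCast_eq_zero_iff, hp.out.dvd_factorial]
  exact not_le.2 hk

/-- Since n = -(r+1) mod p, binom(n, k) is (-1)^k binom(r+k, r), so up to sign a polynomial of
degree r in k. -/
theorem factorial_mul_choose_zmod {n r k : ℕ} (h : r + n + 1 = p) (hk : k < p) :
    (r ! : ZMod p) * n.choose k = (-1) ^ k * (ascPochhammer (ZMod p) r).eval (k + 1 : ZMod p) := by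
  have hr : (r + 1 : ZMod p) = -n := by
    have : ((r + n + 1 : ℕ) : ZMod p) = 0 := by rw [h]; simp
    push_cast at this
    linear_combination this
  have h1 : (k ! : ZMod p) * n.choose k
      = (-1) ^ k * (ascPochhammer (ZMod p) k).eval (r + 1 : ZMod p) := by
    rw [hr, ascPochhammer_eval_neg_eq_descPochhammer, descPochhammer_eval_eq_descFactorial,
      Nat.descFactorial_eq_factorial_mul_choose, ← mul_assoc, ← mul_pow]
    simp
  have h2 := factorial_mul_ascPochhammer (ZMod p) r k
  have h3 := factorial_mul_ascPochhammer (ZMod p) k r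
  rw [add_comm r k] at h2
  refine mul_left_cancel₀ (factorial_ne_zero_zmod hk) ?_
  linear_combination (r ! : ZMod p) * h1 + (-1 : ZMod p) ^ k * (h2 - h3)

theorem factorial_mul_ringChoose_zmod (x : ℤ) (b : ℕ) :
    (b ! : ZMod p) * ((Ring.choose x b : ℤ) : ZMod p)
      = (descPochhammer (ZMod p) b).eval (x : ZMod p) := by
  have h := Ring.descPochhammer_eq_factorial_smul_choose x b
  rw [← descPochhammer_eval_cast, Polynomial.eval_eq_smeval, h]
  simp

theorem sum_neg_one_pow_mul_choose_mul_eval {R : Type*} [CommRing R] {P : Polynomial R} {n : ℕ}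
    (hP : P.natDegree < n) :
    ∑ k ∈ range (n + 1), (-1) ^ k * (n.choose k : R) * P.eval (k : R) = 0 := by
  have h := congrFun (Polynomial.fwdDiff_iter_eq_zero_of_degree_lt hP) 0
  rw [fwdDiff_iter_eq_sum_shift] at h
  have h2 := congrArg ((-1) ^ n * ·) h
  simp only [Pi.zero_apply, mul_zero, mul_sum] at h2
  rw [← h2]
  refine sum_congr rfl fun k hk => ?_
  rw [neg_one_pow_sub_int (by simpa [Nat.lt_succ_iff] using hk), zsmul_eq_mul]
  push_cast
  rw [zero_add, nsmul_one, ← mul_assoc, ← mul_assoc, ← mul_assoc, ← mul_pow]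
  simp

/-- Two of the three binomials become polynomials of degree p - 1 - n, their signs cancelling; the
n-th difference then kills total degree 2(p-1-n) + b < n. -/
theorem alternatingChooseSum_cube_eq_zero {n : ℕ} (hn : n < p) (s b : ℕ)
    (hb : b + 2 * p < 3 * n + 2) :
    (alternatingChooseSum (fun n k => (n.choose k : ℤ) ^ 3) s n b : ZMod p) = 0 := by
  obtain ⟨r, hr⟩ : ∃ r, r + n + 1 = p := ⟨p - 1 - n, by omega⟩
  let P : Polynomial (ZMod p) :=
    ((ascPochhammer (ZMod p) r).comp (Polynomial.X + Polynomial.C 1)) ^ 2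
      * (descPochhammer (ZMod p) b).comp
        (Polynomial.C (-(s + 2) : ZMod p) * Polynomial.X + Polynomial.C ((s + 1) * n : ZMod p))
  have hP : P.natDegree < n := by
    have h1 : P.natDegree ≤ 2 * (r * 1) + b * 1 := by
      refine Polynomial.natDegree_mul_le_of_le (Polynomial.natDegree_pow_le_of_le _ ?_) ?_
      · exact Polynomial.natDegree_comp_le.trans (Nat.mul_le_mul
          (ascPochhammer_natDegree (ZMod p) _).le (Polynomial.natDegree_X_add_C _).le)
      · exact Polynomial.natDegree_comp_le.trans (Nat.mul_le_mul (descPochhammer_natDegree _ _).le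
          Polynomial.natDegree_linear_le)
    omega
  have h := sum_neg_one_pow_mul_choose_mul_eval hP
  have hfac : (r ! : ZMod p) ^ 2 * b ! ≠ 0 := mul_ne_zero
    (pow_ne_zero _ (factorial_ne_zero_zmod (by omega))) (factorial_ne_zero_zmod (by omega))
  refine (mul_eq_zero.1 ?_).resolve_left hfac
  rw [← h, alternatingChooseSum, Int.cast_sum, mul_sum]
  refine sum_congr rfl fun k hk => ?_
  have hk : k ≤ n := by simpa [Nat.lt_succ_iff] using hk
  have h1 := factorial_mul_choose_zmod hr (hk.trans_lt hn)
  have h2 := factorial_mul_ringChoose_zmod (p := p) ((s + 1) * n - (s + 2) * k : ℤ) b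
  have h4 : ((r ! : ZMod p) * n.choose k) ^ 2
      = ((ascPochhammer (ZMod p) r).eval (k + 1 : ZMod p)) ^ 2 := by
    rw [h1, mul_pow, ← pow_mul, mul_comm k, pow_mul]; simp
  have h3 : P.eval (k : ZMod p) = ((r ! : ZMod p) * n.choose k) ^ 2
      * (b ! * ((Ring.choose ((s + 1) * n - (s + 2) * k : ℤ) b : ℤ) : ZMod p)) := by
    rw [h4, h2]
    simp only [P, Polynomial.eval_mul, Polynomial.eval_pow, Polynomial.eval_comp,
      Polynomial.eval_add, Polynomial.eval_X, Polynomial.eval_C]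
    congr 2
    push_cast
    ring
  rw [h3]
  push_cast
  ring

end Vanishing

/-! ### The sequences η and s₁₈. -/

namespace AperyLike

variable {p : ℕ} [hp : Fact p.Prime]

theorem seqEta_eq (n : ℕ) :
    seqEta n = alternatingChooseSum (fun n k => (n.choose k : ℤ) ^ 3) 3 n (3 * n) := by
  rcases eq_or_ne n 0 with rfl | hn
  · simp [seqEta, alternatingChooseSum]
  · rw [seqEta, if_neg hn, ← sum_range_choose_add_choose (by decide) hn
      fun k hk => by rw [Nat.choose_symm hk]]

theorem lucasAt_seqEta : LucasAt p (fun n => (seqEta n : ZMod p)) := by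
  simp only [seqEta_eq]
  refine lucasAt_alternatingChooseSum (by decide) ?_
    (fun n k h => by simp [Nat.choose_eq_zero_of_lt h])
    (fun n k h => by rw [Nat.choose_symm h]) fun n hn i hi h => ?_
  · simpa using (lucasAt₂_choose (p := p)).pow 3
  · refine alternatingChooseSum_cube_eq_zero hn _ _ ?_
    have : p * 2 ≤ p * i := Nat.mul_le_mul_left p hi
    omega

theorem s18_eq (n : ℕ) :
    s18 n = alternatingChooseSum (fun n k => (n.choose k : ℤ) *
      ((2 * (n - k)).choose (n - k) * (2 * k).choose k)) 1 n (1 * n) := by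
  rcases eq_or_ne n 0 with rfl | hn
  · simp [s18, alternatingChooseSum]
  · rw [s18, if_neg hn, ← sum_range_choose_add_choose (by decide) hn
      fun k hk => by rw [Nat.choose_symm hk, Nat.sub_sub_self hk, mul_comm ((2 * k).choose k : ℤ)]]
    refine sum_congr rfl fun k _ => ?_
    simp only [Nat.reduceAdd, one_mul]
    ring

theorem lucasAt_s18 : LucasAt p (fun n => (s18 n : ZMod p)) := by
  simp only [s18_eq]
  refine lucasAt_alternatingChooseSum (by decide) ?_
    (fun n k h => by simp [Nat.choose_eq_zero_of_lt h])
    (fun n k hk => by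
      rw [Nat.choose_symm hk, Nat.sub_sub_self hk, mul_comm ((2 * k).choose k : ℤ)])
    fun n hn i hi h => ?_
  · simpa using lucasAt₂_choose_mul_centralBinom_mul_centralBinom (p := p)
  -- For s = 1 this case is empty: pi ≤ n < p is impossible.
  · have : p * 2 ≤ p * i := Nat.mul_le_mul_left p hi
    omega

end AperyLike

theorem theorem1 :
    SatisfiesLucasCongruences AperyLike.seqA ∧
    SatisfiesLucasCongruences AperyLike.seqB ∧
    SatisfiesLucasCongruences AperyLike.seqC ∧
    SatisfiesLucasCongruences AperyLike.seqD ∧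
    SatisfiesLucasCongruences AperyLike.seqF ∧
    SatisfiesLucasCongruences AperyLike.seqG ∧
    SatisfiesLucasCongruences AperyLike.seqDelta ∧
    SatisfiesLucasCongruences AperyLike.seqEta ∧
    SatisfiesLucasCongruences AperyLike.seqAlpha ∧
    SatisfiesLucasCongruences AperyLike.seqEpsilon ∧
    SatisfiesLucasCongruences AperyLike.seqZeta ∧
    SatisfiesLucasCongruences AperyLike.seqGamma ∧
    SatisfiesLucasCongruences AperyLike.s7 ∧
    SatisfiesLucasCongruences AperyLike.s10 ∧
    SatisfiesLucasCongruences AperyLike.s18 := by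
  refine ⟨?_, ?_, ?_, ?_, ?_, ?_, ?_, ?_, ?_, ?_, ?_, ?_, ?_, ?_, ?_⟩ <;>
    refine satisfiesLucasCongruences_of_lucasAt fun p hp => ?_ <;>
    have : Fact p.Prime := ⟨hp⟩
  · exact AperyLike.lucasAt_seqA
  · exact AperyLike.lucasAt_seqB
  · exact AperyLike.lucasAt_seqC
  · exact AperyLike.lucasAt_seqD
  · exact AperyLike.lucasAt_seqF
  · exact AperyLike.lucasAt_seqG
  · exact AperyLike.lucasAt_seqDelta
  · exact AperyLike.lucasAt_seqEta
  · exact AperyLike.lucasAt_seqAlpha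
  · exact AperyLike.lucasAt_seqEpsilon
  · exact AperyLike.lucasAt_seqZeta
  · exact AperyLike.lucasAt_seqGamma
  · exact AperyLike.lucasAt_s7
  · exact AperyLike.lucasAt_s10
  · exact AperyLike.lucasAt_s18
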